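/- Let $X$ be a Tychonoff space with a distinguished point $e$, and let $B(X)$ be the free Boolean topological group on $X$ in the sense of Graev, that is, the Hausdorff topological group in which $g+g=0$ for all $g$, which contains $X$ as a subspace with $e$ as its zero element, is generated by $X$, and is such that every continuous map $f\colon X\to H$ to a Boolean topological group $H$ (one with $h+h=0$ for all $h\in H$) with $f(e)=0$ extends to a continuous homomorphism $B(X)\to H$. (Concretely, $B(X)$ is the vector space over $\mathbb F_2$ with basis $X\setminus\{e\}$, with $e$ identified with $0$, equipped with the finest group topology for which the canonical map $X\to B(X)$ is continuous.) Then $B(X)$ is Weil complete (complete with respect to its left group uniformity) if and only if $X$ is Dieudonné complete (the topology of $X$ is induced by some complete uniformity). Moreover, $B(X)$ is Weil complete if and only if it is Raĭkov complete (complete with respect to its two-sided group uniformity), and $X$ is Dieudonné complete if and only if its universal uniformity, i.e. the finest uniformity that induces the topology of $X$, is complete. -/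

import Mathlib

open Set Filter Topology

universe u v

/-- The free Boolean group on a set `X` with distinguished point `e`: the vector space over the
two-element field with basis `X \ {e}`. -/
def FreeBoolean {X : Type u} (e : X) : Type u := {x : X // x ≠ e} →₀ ZMod 2

namespace FreeBoolean

noncomputable section

instance instAddCommGroup {X : Type u} (e : X) : AddCommGroup (FreeBoolean e) :=
  inferInstanceAs (AddCommGroup ({x : X // x ≠ e} →₀ ZMod 2))

open Classical in
/-- The canonical map of `X` to the free Boolean group: a point `x ≠ e` goes to the
corresponding basis vector, and `e` goes to zero. -/
def of {X : Type u} (e : X) (x : X) : FreeBoolean e :=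
  if h : x = e then 0 else (Finsupp.single ⟨x, h⟩ 1 : {x : X // x ≠ e} →₀ ZMod 2)

/-- The topology of the free Boolean topological group `B(X)`: the finest group topology for
which the canonical map of `X` is continuous. -/
instance instTopologicalSpace {X : Type u} [TopologicalSpace X] (e : X) :
    TopologicalSpace (FreeBoolean e) :=
  (AddGroupTopology.coinduced (of e)).toTopologicalSpace

instance instIsTopologicalAddGroup {X : Type u} [TopologicalSpace X] (e : X) :
    IsTopologicalAddGroup (FreeBoolean e) :=
  (AddGroupTopology.coinduced (of e)).toIsTopologicalAddGroup

theorem add_self {X : Type u} (e : X) (g : FreeBoolean e) : g + g = 0 := by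
  refine Finsupp.ext fun x => ?_
  exact CharTwo.add_self_eq_zero (R := ZMod 2) ((show {x : X // x ≠ e} →₀ ZMod 2 from g) x)

theorem of_base {X : Type u} (e : X) : of e e = 0 := by
  simp [of]

theorem of_ne {X : Type u} (e : X) (x : {x : X // x ≠ e}) :
    of e x = (Finsupp.single x 1 : {x : X // x ≠ e} →₀ ZMod 2) := by
  exact dif_neg x.2

theorem of_injective {X : Type u} (e : X) : Function.Injective (of e) := by
  intro x y h
  by_cases hx : x = e <;> by_cases hy : y = e
  · rw [hx, hy]
  · exfalso
    rw [hx, of_base, of_ne e ⟨y, hy⟩] at h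
    exact one_ne_zero (Finsupp.single_eq_zero.1 h.symm)
  · exfalso
    rw [hy, of_base, of_ne e ⟨x, hx⟩] at h
    exact one_ne_zero (Finsupp.single_eq_zero.1 h)
  · rw [of_ne e ⟨x, hx⟩, of_ne e ⟨y, hy⟩] at h
    have := Finsupp.single_left_injective (one_ne_zero) h
    exact congrArg Subtype.val this

/-- `B(X)` is generated by `X`. -/
theorem closure_range_of {X : Type u} (e : X) : AddSubgroup.closure (range (of e)) = ⊤ := by
  rw [eq_top_iff]
  intro g _
  refine Finsupp.induction_linear (motive := fun g : {x : X // x ≠ e} →₀ ZMod 2 =>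
    (show FreeBoolean e from g) ∈ AddSubgroup.closure (range (of e))) g ?_ ?_ ?_
  · exact AddSubgroup.zero_mem _
  · exact fun a b ha hb => AddSubgroup.add_mem _ ha hb
  · intro x a
    have ha : a = 0 ∨ a = 1 := by revert a; decide
    rcases ha with rfl | rfl
    · rw [Finsupp.single_zero]; exact AddSubgroup.zero_mem _
    · rw [← of_ne]; exact AddSubgroup.subset_closure ⟨x, rfl⟩

/-- The algebraic universal property. -/
theorem exists_hom {X : Type u} (e : X) {H : Type v} [AddCommGroup H]
    (hH : ∀ h : H, h + h = 0) (f : X → H) (hf : f e = 0) :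
    ∃ F : FreeBoolean e →+ H, ∀ x, F (of e x) = f x := by
  have h2 : ∀ h : H, (2 : ℕ) • h = 0 := fun h => by rw [two_nsmul, hH]
  let _ : Module (ZMod 2) H := AddCommGroup.zmodModule h2
  let F : ({x : X // x ≠ e} →₀ ZMod 2) →ₗ[ZMod 2] H :=
    Finsupp.linearCombination (ZMod 2) (fun x : {x : X // x ≠ e} => f x)
  refine ⟨F.toAddMonoidHom, fun x => ?_⟩
  by_cases hx : x = e
  · rw [hx, of_base, hf]; exact map_zero _
  · rw [of_ne e ⟨x, hx⟩]
    exact (Finsupp.linearCombination_single _ _ _).trans (one_smul _ _)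

theorem continuous_of {X : Type u} [TopologicalSpace X] (e : X) : Continuous (of e) :=
  AddGroupTopology.coinduced_continuous (of e)

/-- A group homomorphism from `B(X)` is continuous if its restriction to `X` is. -/
theorem continuous_hom {X : Type u} [TopologicalSpace X] (e : X) {H : Type v} [AddGroup H]
    [TopologicalSpace H] [IsTopologicalAddGroup H] (F : FreeBoolean e →+ H)
    (hF : Continuous fun x => F (of e x)) : Continuous F := by
  let t : AddGroupTopology (FreeBoolean e) :=
    { toTopologicalSpace := TopologicalSpace.induced F inferInstance
      toIsTopologicalAddGroup := topologicalAddGroup_induced F }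
  have h : AddGroupTopology.coinduced (of e) ≤ t := by
    refine sInf_le ?_
    exact continuous_iff_coinduced_le.1 (continuous_induced_rng.2 hF)
  rw [continuous_iff_le_induced]
  exact h

/-- The universal property of `B(X)`: a continuous map `f : X → H` to a Boolean topological group
with `f e = 0` extends to a unique continuous homomorphism. -/
theorem existsUnique_lift {X : Type u} [TopologicalSpace X] (e : X) {H : Type v} [AddCommGroup H]
    [TopologicalSpace H] [IsTopologicalAddGroup H] (hH : ∀ h : H, h + h = 0)
    (f : X → H) (hfc : Continuous f) (hf : f e = 0) :
    ∃! F : FreeBoolean e →+ H, Continuous F ∧ ∀ x, F (of e x) = f x := by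
  obtain ⟨F, hF⟩ := exists_hom e hH f hf
  refine ⟨F, ⟨continuous_hom e F (by simpa only [hF] using hfc), hF⟩, ?_⟩
  rintro G ⟨-, hG⟩
  refine AddMonoidHom.eq_of_eqOn_dense (closure_range_of e) ?_
  rintro _ ⟨x, rfl⟩
  rw [hF, hG]

/-- A continuous real function `f` on `X` gives homomorphisms `φ t` of `B(X)` to the two-element
group, and `g ↦ measure of {t ∈ [0, 1] | φ t g ≠ 0}` is a continuous seminorm on `B(X)`. -/
theorem exists_seminorm {X : Type u} [TopologicalSpace X] (e : X) (f : X → ℝ)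
    (hf : Continuous f) :
    ∃ φ : ℝ → FreeBoolean e →+ ZMod 2,
      (∀ t x, φ t (of e x) = (if t < f x then 1 else 0) + (if t < f e then 1 else 0)) ∧
      Continuous fun g : FreeBoolean e =>
        (MeasureTheory.volume.restrict (Icc (0 : ℝ) 1)).real {t | φ t g ≠ 0} := by
  have h2 : ∀ h : ZMod 2, h + h = 0 := CharTwo.add_self_eq_zero
  choose φ hφ using fun t : ℝ => exists_hom e h2
    (fun x => (if t < f x then (1 : ZMod 2) else 0) + (if t < f e then 1 else 0)) (h2 _)
  refine ⟨φ, hφ, ?_⟩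
  let μ : MeasureTheory.Measure ℝ := MeasureTheory.volume.restrict (Icc (0 : ℝ) 1)
  let N : AddGroupSeminorm (FreeBoolean e) :=
    { toFun := fun g => μ.real {t | φ t g ≠ 0}
      map_zero' := by simp
      add_le' := fun a b => by
        refine (MeasureTheory.measureReal_mono ?_).trans (MeasureTheory.measureReal_union_le _ _)
        intro t ht
        by_contra hc
        simp only [mem_union, mem_ofPred_eq, not_or, not_not] at hc
        exact ht (by rw [map_add, hc.1, hc.2, add_zero])
      neg' := fun a => by simp }
  let S : SeminormedAddCommGroup (FreeBoolean e) := N.toSeminormedAddCommGroup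
  let tS : TopologicalSpace (FreeBoolean e) := S.toPseudoMetricSpace.toUniformSpace.toTopologicalSpace
  have hg : @IsTopologicalAddGroup (FreeBoolean e) tS _ := inferInstance
  have hof : @Continuous X (FreeBoolean e) _ tS (of e) := by
    rw [continuous_iff_continuousAt]
    intro x
    rw [ContinuousAt, tendsto_iff_norm_sub_tendsto_zero]
    have hb : ∀ y, ‖of e y - of e x‖ ≤ |f y - f x| := by
      intro y
      change μ.real {t | φ t (of e y - of e x) ≠ 0} ≤ _
      have hsub : {t | φ t (of e y - of e x) ≠ 0} ⊆ uIcc (f x) (f y) := by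
        intro t ht
        rw [mem_ofPred_eq, map_sub, hφ, hφ] at ht
        rw [mem_uIcc]
        by_contra hc
        push Not at hc
        apply ht
        by_cases h1 : t < f x <;> by_cases h2 : t < f y
        · simp [h1, h2]
        · exact absurd h1 (not_lt.2 (not_lt.1 fun h => absurd (hc.2 (not_lt.1 h2)) (not_lt.2 h.le)))
        · exact absurd h2 (not_lt.2 (hc.1 (not_lt.1 h1)).le)
        · simp [h1, h2]
      calc μ.real _ ≤ MeasureTheory.volume.real (uIcc (f x) (f y)) := by
            refine ENNReal.toReal_mono (by simp) ?_
            exact (MeasureTheory.measure_mono hsub).trans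
              (MeasureTheory.Measure.restrict_apply_le _ _)
        _ = |f y - f x| := by simp [MeasureTheory.measureReal_def]
    refine squeeze_zero (fun _ => norm_nonneg _) hb ?_
    have : Continuous fun y => |f y - f x| := by fun_prop
    simpa using this.tendsto x
  have hn : @Continuous (FreeBoolean e) ℝ tS _ (fun g => μ.real {t | φ t g ≠ 0}) :=
    continuous_norm
  have hid : @Continuous (FreeBoolean e) (FreeBoolean e) (instTopologicalSpace e) tS id :=
    @continuous_hom X _ e (FreeBoolean e) _ tS hg (AddMonoidHom.id _) hof
  exact @Continuous.comp _ _ _ (instTopologicalSpace e) tS _ _ _ hn hid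

/-- For a Tychonoff space `X` the canonical map embeds `X` in `B(X)` as a subspace. -/
theorem isEmbedding_of {X : Type u} [TopologicalSpace X] [T35Space X] (e : X) :
    IsEmbedding (of e) := by
  refine ⟨⟨le_antisymm (continuous_iff_le_induced.1 (continuous_of e)) ?_⟩, of_injective e⟩
  rw [le_iff_nhds]
  intro x s hs
  obtain ⟨U, hUs, hU, hxU⟩ := mem_nhds_iff.1 hs
  obtain ⟨f, hf, hfx, hfK⟩ := CompletelyRegularSpace.completely_regular_isOpen x U hU hxU
  obtain ⟨φ, hφ, hN⟩ := exists_seminorm e (fun y => (f y : ℝ)) (by fun_prop)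
  have hc : Continuous fun g : FreeBoolean e =>
      (MeasureTheory.volume.restrict (Icc (0 : ℝ) 1)).real {t | φ t (g - of e x) ≠ 0} :=
    hN.comp (continuous_id.sub continuous_const)
  rw [nhds_induced]
  refine ⟨_, (isOpen_Iio (a := (1 : ℝ)).preimage hc).mem_nhds (by simp), ?_⟩
  intro y hy
  apply hUs
  by_contra hyU
  have hy1 : f y = 1 := hfK hyU
  have : Ico (0 : ℝ) 1 ⊆ {t | φ t (of e y - of e x) ≠ 0} := by
    intro t ht
    simp [hφ, hfx, hy1, ht.2, not_lt.2 ht.1]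
  have h1 := MeasureTheory.measureReal_mono (μ := MeasureTheory.volume.restrict (Icc (0 : ℝ) 1)) this
  have h2 : (MeasureTheory.volume.restrict (Icc (0 : ℝ) 1)).real (Ico (0 : ℝ) 1) = 1 := by
    rw [MeasureTheory.measureReal_restrict_apply measurableSet_Ico,
      inter_eq_left.2 Ico_subset_Icc_self]
    simp
  rw [h2] at h1
  exact absurd hy (not_lt.2 h1)

/-- For a Tychonoff space `X` the group `B(X)` is Hausdorff. -/
instance instT2Space {X : Type u} [TopologicalSpace X] [T35Space X] (e : X) :
    T2Space (FreeBoolean e) := by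
  suffices h : ∀ g : FreeBoolean e, g ≠ 0 → ∃ N : FreeBoolean e → ℝ, Continuous N ∧ N g ≠ N 0 by
    refine t2Space_iff_disjoint_nhds.2 fun a b hab => ?_
    obtain ⟨N, hN, hne⟩ := h (a - b) (sub_ne_zero.2 hab)
    have hc : Continuous fun g => N (g - b) := hN.comp (continuous_id.sub continuous_const)
    refine Filter.disjoint_of_map (f := fun g => N (g - b)) ?_
    refine Disjoint.mono hc.continuousAt hc.continuousAt ?_
    simpa using hne
  intro g hg
  obtain ⟨x, hx⟩ := Finsupp.ne_iff.1
    (show (show {x : X // x ≠ e} →₀ ZMod 2 from g) ≠ 0 from hg)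
  let s : Finset {x : X // x ≠ e} := (show {x : X // x ≠ e} →₀ ZMod 2 from g).support
  let K : Set X := insert e (Subtype.val '' ((s : Set {x : X // x ≠ e}) \ {x}))
  have hK : IsClosed K := ((s.finite_toSet.sdiff.image _).insert e).isClosed
  have hxK : (x : X) ∉ K := by
    rintro (h | ⟨y, hy, h⟩)
    · exact x.2 h
    · exact hy.2 (Subtype.ext h)
  obtain ⟨f, hf, hfx, hfK⟩ := CompletelyRegularSpace.completely_regular (x : X) K hK hxK
  obtain ⟨φ, hφ, hN⟩ := exists_seminorm e (fun y => 1 - (f y : ℝ)) (by fun_prop)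
  refine ⟨_, hN, ?_⟩
  have key : ∀ t ∈ Ico (0 : ℝ) 1, φ t g ≠ 0 := by
    intro t ht
    have hsum : g = ∑ y ∈ s, of e y := by
      refine (Finsupp.sum_single (show {x : X // x ≠ e} →₀ ZMod 2 from g)).symm.trans ?_
      refine Finset.sum_congr rfl fun y hy => ?_
      have h01 : ∀ a : ZMod 2, a ≠ 0 → a = 1 := by decide
      rw [of_ne, h01 _ (Finsupp.mem_support_iff.1 hy)]
    have hfe : f e = 1 := hfK (mem_insert _ _)
    rw [hsum, map_sum, Finset.sum_eq_single_of_mem x (Finsupp.mem_support_iff.2 hx)]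
    · simp [hφ, hfx, hfe, ht.2, not_lt.2 ht.1]
    · intro y hy hyx
      have : f y = 1 := hfK (mem_insert_of_mem _ ⟨y, ⟨hy, hyx⟩, rfl⟩)
      simp [hφ, hfe, this, not_lt.2 ht.1]
  have h1 := MeasureTheory.measureReal_mono (μ := MeasureTheory.volume.restrict (Icc (0 : ℝ) 1))
    (show Ico (0 : ℝ) 1 ⊆ {t | φ t g ≠ 0} from key)
  have h2 : (MeasureTheory.volume.restrict (Icc (0 : ℝ) 1)).real (Ico (0 : ℝ) 1) = 1 := by
    rw [MeasureTheory.measureReal_restrict_apply measurableSet_Ico,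
      inter_eq_left.2 Ico_subset_Icc_self]
    simp
  rw [h2] at h1
  have h0 : (MeasureTheory.volume.restrict (Icc (0 : ℝ) 1)).real {t | φ t 0 ≠ 0} = 0 := by simp
  change (MeasureTheory.volume.restrict (Icc (0 : ℝ) 1)).real {t | φ t g ≠ 0} ≠
    (MeasureTheory.volume.restrict (Icc (0 : ℝ) 1)).real {t | φ t 0 ≠ 0}
  rw [h0]
  linarith

end

end FreeBoolean

/-- A topological group is Weil complete if its left uniformity is complete. -/
def WeilComplete (G : Type u) [AddGroup G] [TopologicalSpace G] [IsTopologicalAddGroup G] : Prop :=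
  @CompleteSpace G (IsTopologicalAddGroup.leftUniformSpace G)

/-- A topological group is Raikov complete if its two-sided uniformity, the supremum of the left
and right uniformities (an infimum in Mathlib's order), is complete. -/
def RaikovComplete (G : Type u) [AddGroup G] [TopologicalSpace G] [IsTopologicalAddGroup G] :
    Prop :=
  @CompleteSpace G
    (IsTopologicalAddGroup.leftUniformSpace G ⊓ IsTopologicalAddGroup.rightUniformSpace G)

/-- A space is Dieudonné complete if its topology is induced by a complete uniformity. -/
def DieudonneComplete (X : Type u) [t : TopologicalSpace X] : Prop :=
  ∃ U : UniformSpace X, U.toTopologicalSpace = t ∧ @CompleteSpace X U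

/-- The universal uniformity of a space: the finest uniformity that induces its topology (the
order on uniformities has the finer one below). -/
@[reducible] def universalUniformity (X : Type u) [t : TopologicalSpace X] : UniformSpace X :=
  sInf {U : UniformSpace X | U.toTopologicalSpace = t}

/-- On a completely regular space the universal uniformity does induce the topology. -/
theorem universalUniformity_toTopologicalSpace (X : Type u) [t : TopologicalSpace X]
    [CompletelyRegularSpace X] : (universalUniformity X).toTopologicalSpace = t := by
  obtain ⟨U, hU⟩ := CompletelyRegularSpace.exists_uniformSpace (X := X)
  rw [universalUniformity, UniformSpace.toTopologicalSpace_sInf]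
  refine le_antisymm (iInf₂_le_of_le U hU hU.le) (le_iInf₂ fun V hV => ?_)
  exact (show V.toTopologicalSpace = t from hV).ge

/-! Suppose X is complete in some compatible uniformity, and let F be a Cauchy filter on B(X).
First, F can be replaced by a Cauchy filter of words of bounded length (`exists_lengthLE`,
`exists_mem`). If this failed for every length, the excluded neighbourhoods would yield a basic
neighbourhood of zero, made of sums of pairs of letters (`pairSums_mem_nhds`), that contradicts the
Cauchy condition. Then induct on the bound n + 1. Either F can be pushed to words of length n, or F
lives on words of length exactly n + 1 whose letters are uniformly separated from each other and
from e. In the second case, close words have close letters (`exists_nhds_close`), so each letter of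
a fixed word can be followed through F. The letters form Cauchy filters on X, and F converges to the
sum of their limits. Conversely, X embeds in B(X) as a closed subspace, so completeness of B(X)
passes to X. The tool for lower bounds is the seminorm of a real function f: the measure of the
levels t in [0, 1] at which a word has odd parity in {f > t}, each letter counted relative to e. -/

/-! ### Continuous pseudometrics -/

/-- A continuous pseudometric on a topological space, as a two-variable function. -/
structure IsContinuousPseudometric {X : Type u} [TopologicalSpace X] (d : X → X → ℝ) : Prop where
  self : ∀ x, d x x = 0
  comm : ∀ x y, d x y = d y x
  triangle : ∀ x y z, d x z ≤ d x y + d y z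
  tendsto : ∀ x, Tendsto (d x) (𝓝 x) (𝓝 0)

namespace IsContinuousPseudometric

variable {X : Type u} [TopologicalSpace X] {d d' : X → X → ℝ}

theorem nonneg (h : IsContinuousPseudometric d) (x y : X) : 0 ≤ d x y := by
  have h1 := h.triangle x y x
  rw [h.self, h.comm y x] at h1
  linarith

theorem add (h : IsContinuousPseudometric d) (h' : IsContinuousPseudometric d') :
    IsContinuousPseudometric fun x y => d x y + d' x y where
  self x := by rw [h.self, h'.self, add_zero]
  comm x y := by rw [h.comm, h'.comm]
  triangle x y z := by linarith [h.triangle x y z, h'.triangle x y z]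
  tendsto x := by simpa using (h.tendsto x).add (h'.tendsto x)

theorem comp {Y : Type v} [TopologicalSpace Y] (h : IsContinuousPseudometric d) {f : Y → X}
    (hf : Continuous f) : IsContinuousPseudometric fun x y => d (f x) (f y) where
  self _ := h.self _
  comm _ _ := h.comm _ _
  triangle _ _ _ := h.triangle _ _ _
  tendsto x := (h.tendsto (f x)).comp hf.continuousAt

end IsContinuousPseudometric

/-- Every entourage of a uniform space contains the unit entourage of a continuous pseudometric. -/
theorem exists_isContinuousPseudometric {X : Type u} [u₀ : UniformSpace X] {V : Set (X × X)}
    (hV : V ∈ uniformity X) :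
    ∃ d : X → X → ℝ, IsContinuousPseudometric d ∧ ∀ x y, d x y < 1 → (x, y) ∈ V := by
  have hstep : ∀ W : {W : Set (X × X) // W ∈ uniformity X}, ∃ W' : {W : Set (X × X) //
      W ∈ uniformity X}, (∀ x y, (x, y) ∈ W'.1 → (y, x) ∈ W'.1) ∧
      (∀ x y z, (x, y) ∈ W'.1 → (y, z) ∈ W'.1 → (x, z) ∈ W.1) := by
    rintro ⟨W, hW⟩
    obtain ⟨W', hW', hs, hc⟩ := comp_symm_mem_uniformity_sets hW
    exact ⟨⟨W', hW'⟩, fun x y h => hs.symm _ _ h, fun x y z h h' => hc ⟨y, h, h'⟩⟩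
  choose c hcs hcc using hstep
  -- The exponent n + 1 makes already `v 0` symmetric; V itself need not be.
  let v : ℕ → {W : Set (X × X) // W ∈ uniformity X} := fun n => c^[n + 1] ⟨V, hV⟩
  have hv : ∀ n, v (n + 1) = c (v n) := fun n => Function.iterate_succ_apply' _ _ _
  have hrefl : ∀ n x, (x, x) ∈ (v n).1 := fun n x => @refl_mem_uniformity X u₀ x _ (v n).2
  have hsymm : ∀ n x y, (x, y) ∈ (v n).1 → (y, x) ∈ (v n).1 := by
    rintro (_ | n)
    · exact hcs _
    · rw [hv]; exact hcs _
  have hcomp : ∀ n x y z, (x, y) ∈ (v (n + 1)).1 → (y, z) ∈ (v (n + 1)).1 → (x, z) ∈ (v n).1 := by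
    intro n
    rw [hv]; exact hcc _
  have hanti : Antitone fun n => (v n).1 :=
    antitone_nat_of_succ_le fun n => by
      rintro ⟨x, y⟩ h
      exact hcomp n x y y h (hrefl _ _)
  have hv0 : (v 0).1 ⊆ V := by
    rintro ⟨x, y⟩ h
    exact hcc ⟨V, hV⟩ x y y h (hrefl 0 y)
  let B : FilterBasis (X × X) :=
    { sets := range fun n => (v n).1
      nonempty := range_nonempty _
      inter_sets := by
        rintro _ _ ⟨m, rfl⟩ ⟨n, rfl⟩
        exact ⟨_, ⟨max m n, rfl⟩, subset_inter (hanti (le_max_left _ _)) (hanti (le_max_right _ _))⟩ }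
  let C : UniformSpace.Core X := UniformSpace.Core.mkOfBasis B
    (by rintro _ ⟨n, rfl⟩ x; exact hrefl n x)
    (by rintro _ ⟨n, rfl⟩; exact ⟨_, ⟨n, rfl⟩, fun p h => hsymm n _ _ h⟩)
    (by
      rintro _ ⟨n, rfl⟩
      refine ⟨_, ⟨n + 1, rfl⟩, ?_⟩
      rintro ⟨x, z⟩ ⟨y, h, h'⟩
      exact hcomp n x y z h h')
  -- This uniformity has a countable base, so it is pseudometrizable. It is coarser than the given
  -- one, which is all that continuity needs.
  let U : UniformSpace X := UniformSpace.ofCore C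
  have hU : (@uniformity X U) = B.filter := rfl
  have hcg : IsCountablyGenerated (@uniformity X U) := by
    rw [hU]
    exact HasCountableBasis.isCountablyGenerated
      ⟨B.hasBasis, countable_range (fun n => (v n).1)⟩
  obtain ⟨I, hI⟩ := @UniformSpace.metrizable_uniformity X U hcg
  have hle : @uniformity X u₀ ≤ @uniformity X I.toUniformSpace := by
    rw [hI, hU]
    intro s hs
    obtain ⟨_, ⟨n, rfl⟩, hn⟩ := B.mem_filter_iff.1 hs
    exact mem_of_superset (v n).2 hn
  have hVI : V ∈ @uniformity X I.toUniformSpace := by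
    rw [hI, hU]
    exact B.mem_filter_iff.2 ⟨(v 0).1, ⟨0, rfl⟩, hv0⟩
  obtain ⟨ε, hε, hεV⟩ := (@Metric.mem_uniformity_dist X I V).1 hVI
  refine ⟨fun x y => I.dist x y / ε, ?_, ?_⟩
  swap
  · intro x y h
    exact hεV ((div_lt_one hε).1 h)
  refine @IsContinuousPseudometric.mk X u₀.toTopologicalSpace _ ?_ ?_ ?_ ?_
  · intro x
    rw [I.dist_self, zero_div]
  · intro x y
    rw [I.dist_comm]
  · intro x y z
    rw [← add_div]
    gcongr
    exact I.dist_triangle x y z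
  · intro x
    rw [Metric.tendsto_nhds]
    intro r hr
    have h1 : {p : X × X | I.dist p.1 p.2 < r * ε} ∈ @uniformity X u₀ :=
      hle (@Metric.dist_mem_uniformity X I _ (mul_pos hr hε))
    filter_upwards [@mem_nhds_left X u₀ x _ h1] with y hy
    have h0 : 0 ≤ I.dist x y := @dist_nonneg X I x y
    rw [Real.dist_0_eq_abs, abs_of_nonneg (div_nonneg h0 hε.le), div_lt_iff₀ hε]
    exact hy

/-! ### Words and their length -/

namespace FreeBoolean

theorem neg_eq_self {X : Type u} (e : X) (g : FreeBoolean e) : -g = g :=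
  neg_eq_of_add_eq_zero_left (add_self e g)

theorem sub_eq_add {X : Type u} (e : X) (g h : FreeBoolean e) : g - h = g + h := by
  rw [sub_eq_add_neg, neg_eq_self]

theorem add_add_cancel_self {X : Type u} (e : X) (g h : FreeBoolean e) : g + (g + h) = h := by
  rw [← add_assoc, add_self, zero_add]

theorem exists_finset_sum_eq {X : Type u} (e : X) (g : FreeBoolean e) :
    ∃ s : Finset X, ∑ x ∈ s, of e x = g := by
  classical
  refine ⟨(show {x : X // x ≠ e} →₀ ZMod 2 from g).support.map (Function.Embedding.subtype _), ?_⟩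
  rw [Finset.sum_map]
  refine Eq.trans ?_ (Finsupp.sum_single (show {x : X // x ≠ e} →₀ ZMod 2 from g))
  refine Finset.sum_congr rfl fun y hy => ?_
  have h01 : ∀ a : ZMod 2, a ≠ 0 → a = 1 := by decide
  rw [h01 _ (Finsupp.mem_support_iff.1 hy)]
  exact of_ne e y

open Classical in
theorem sum_add_sum {X : Type u} (e : X) (s t : Finset X) :
    ∑ x ∈ s, of e x + ∑ x ∈ t, of e x = ∑ x ∈ symmDiff s t, of e x := by
  rw [← Finset.sum_inter_add_sum_sdiff s t, ← Finset.sum_inter_add_sum_sdiff t s,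
    Finset.inter_comm t s, add_add_add_comm, add_self, zero_add, symmDiff_def,
    Finset.sup_eq_union, Finset.sum_union disjoint_sdiff_sdiff]

/-- The elements of the free Boolean group which are sums of at most `n` generators. -/
def lengthLE {X : Type u} (e : X) (n : ℕ) : Set (FreeBoolean e) :=
  {g | ∃ s : Finset X, s.card ≤ n ∧ ∑ x ∈ s, of e x = g}

theorem zero_mem_lengthLE {X : Type u} (e : X) (n : ℕ) : (0 : FreeBoolean e) ∈ lengthLE e n :=
  ⟨∅, by simp, by simp⟩

theorem of_mem_lengthLE {X : Type u} (e x : X) : of e x ∈ lengthLE e 1 :=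
  ⟨{x}, by simp, by simp⟩

theorem add_mem_lengthLE {X : Type u} (e : X) {m n : ℕ} {g h : FreeBoolean e}
    (hg : g ∈ lengthLE e m) (hh : h ∈ lengthLE e n) : g + h ∈ lengthLE e (m + n) := by
  classical
  obtain ⟨s, hs, rfl⟩ := hg
  obtain ⟨t, ht, rfl⟩ := hh
  refine ⟨symmDiff s t, ?_, (sum_add_sum e s t).symm⟩
  rw [symmDiff_def, Finset.sup_eq_union]
  refine (Finset.card_union_le _ _).trans (add_le_add ?_ ?_)
  · exact (Finset.card_le_card Finset.sdiff_subset).trans hs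
  · exact (Finset.card_le_card Finset.sdiff_subset).trans ht

theorem sum_range_mem_lengthLE {X : Type u} (e : X) {v : ℕ → FreeBoolean e}
    (hv : ∀ i, ∃ x y, v i = of e x + of e y) (n : ℕ) :
    ∑ i ∈ Finset.range n, v i ∈ lengthLE e (2 * n) := by
  induction n with
  | zero => exact zero_mem_lengthLE e _
  | succ n ih =>
    rw [Finset.sum_range_succ]
    obtain ⟨x, y, h⟩ := hv n
    rw [h]
    exact add_mem_lengthLE e ih (add_mem_lengthLE e (of_mem_lengthLE e x) (of_mem_lengthLE e y))

/-! ### Neighbourhoods of zero made of sums of pairs -/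

/-- The finite sums of pairs of generators, the `i`-th of which lies in `W i`. -/
def pairSums {X : Type u} (e : X) (W : ℕ → Set (FreeBoolean e)) : Set (FreeBoolean e) :=
  {g | ∃ v : ℕ → FreeBoolean e, (∀ i, v i ∈ W i ∧ ∃ x y, v i = of e x + of e y) ∧
    ∃ k, ∑ i ∈ Finset.range k, v i = g}

/-- Zero is itself the pair `of e e + of e e`, so a finite sum can be continued by zeros. This lets
sums of different lengths be compared. -/
theorem exists_of_mem_pairSums {X : Type u} {e : X} {W : ℕ → Set (FreeBoolean e)}
    (hW : ∀ i, (0 : FreeBoolean e) ∈ W i) {g : FreeBoolean e} (hg : g ∈ pairSums e W) :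
    ∃ v : ℕ → FreeBoolean e, (∀ i, v i ∈ W i ∧ ∃ x y, v i = of e x + of e y) ∧
      ∃ k, ∀ n, k ≤ n → ∑ i ∈ Finset.range n, v i = g := by
  obtain ⟨v, hv, k, rfl⟩ := hg
  refine ⟨fun i => if i < k then v i else 0, fun i => ?_, k, fun n hn => ?_⟩
  · by_cases hi : i < k
    · simpa only [hi, if_true] using hv i
    · simpa only [hi, if_false] using ⟨hW i, e, e, (add_self e _).symm⟩
  · rw [← Finset.sum_subset (Finset.range_mono hn)]
    · exact Finset.sum_congr rfl fun i hi => if_pos (Finset.mem_range.1 hi)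
    · exact fun i _ hi => if_neg fun h => hi (Finset.mem_range.2 h)

theorem pairSums_mono {X : Type u} {e : X} {W W' : ℕ → Set (FreeBoolean e)}
    (h : ∀ i, W i ⊆ W' i) : pairSums e W ⊆ pairSums e W' :=
  fun _ ⟨v, hv, hk⟩ => ⟨v, fun i => ⟨h i (hv i).1, (hv i).2⟩, hk⟩

/-- Interleave the two sums, one at the even and the other at the odd indices. -/
theorem add_mem_pairSums {X : Type u} {e : X} {W : ℕ → Set (FreeBoolean e)}
    (hW : ∀ i, (0 : FreeBoolean e) ∈ W i) {g h : FreeBoolean e}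
    (hg : g ∈ pairSums e fun i => W (2 * i) ∩ W (2 * i + 1))
    (hh : h ∈ pairSums e fun i => W (2 * i) ∩ W (2 * i + 1)) : g + h ∈ pairSums e W := by
  obtain ⟨v, hv, k, hk⟩ := exists_of_mem_pairSums (fun i => mem_inter (hW _) (hW _)) hg
  obtain ⟨w, hw, l, hl⟩ := exists_of_mem_pairSums (fun i => mem_inter (hW _) (hW _)) hh
  refine ⟨fun i => if i % 2 = 0 then v (i / 2) else w (i / 2), fun i => ?_, 2 * max k l, ?_⟩
  · obtain ⟨j, rfl | rfl⟩ := Nat.even_or_odd' i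
    · have h1 : 2 * j / 2 = j := by omega
      simpa [h1] using ⟨(hv j).1.1, (hv j).2⟩
    · have h1 : (2 * j + 1) / 2 = j := by omega
      have h2 : (2 * j + 1) % 2 = 1 := by omega
      simpa [h1, h2] using ⟨(hw j).1.2, (hw j).2⟩
  · have key : ∀ n, ∑ i ∈ Finset.range (2 * n), (if i % 2 = 0 then v (i / 2) else w (i / 2)) =
        ∑ i ∈ Finset.range n, v i + ∑ i ∈ Finset.range n, w i := by
      intro n
      induction n with
      | zero => simp
      | succ n ih =>
        have h1 : 2 * n / 2 = n := by omega
        have h2 : (2 * n + 1) / 2 = n := by omega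
        have h3 : (2 * n + 1) % 2 = 1 := by omega
        rw [Nat.mul_succ, Finset.sum_range_succ, Finset.sum_range_succ, ih, Finset.sum_range_succ,
          Finset.sum_range_succ]
        simp only [h1, h2, h3, Nat.mul_mod_right, if_true, one_ne_zero, if_false]
        abel
    rw [key, hk _ (le_max_left _ _), hl _ (le_max_right _ _)]

/-- The sets `pairSums e W` are neighbourhoods of zero in the free Boolean topological group. -/
theorem pairSums_mem_nhds {X : Type u} [TopologicalSpace X] (e : X) {W : ℕ → Set (FreeBoolean e)}
    (hW : ∀ i, W i ∈ 𝓝 (0 : FreeBoolean e)) : pairSums e W ∈ 𝓝 (0 : FreeBoolean e) := by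
  have hz : ∀ {W : ℕ → Set (FreeBoolean e)}, (∀ i, W i ∈ 𝓝 (0 : FreeBoolean e)) →
      ∀ i, (0 : FreeBoolean e) ∈ W i := fun hW i => mem_of_mem_nhds (hW i)
  -- These sets are a base at zero of a group topology making `of e` continuous; the topology of
  -- B(X) is the finest such topology.
  let B : AddGroupFilterBasis (FreeBoolean e) := addGroupFilterBasisOfComm
    {U | ∃ W : ℕ → Set (FreeBoolean e), (∀ i, W i ∈ 𝓝 (0 : FreeBoolean e)) ∧ pairSums e W = U}
    ⟨_, W, hW, rfl⟩
    (by
      rintro _ _ ⟨W, hW, rfl⟩ ⟨W', hW', rfl⟩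
      exact ⟨_, ⟨fun i => W i ∩ W' i, fun i => inter_mem (hW i) (hW' i), rfl⟩,
        subset_inter (pairSums_mono fun i => inter_subset_left)
          (pairSums_mono fun i => inter_subset_right)⟩)
    (by
      rintro _ ⟨W, hW, rfl⟩
      exact ⟨fun _ => 0, fun i => ⟨hz hW i, e, e, (add_self e _).symm⟩, 0, rfl⟩)
    (by
      rintro _ ⟨W, hW, rfl⟩
      refine ⟨_, ⟨fun i => W (2 * i) ∩ W (2 * i + 1), fun i => inter_mem (hW _) (hW _), rfl⟩, ?_⟩
      rintro _ ⟨g, hg, h, hh, rfl⟩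
      exact add_mem_pairSums (hz hW) hg hh)
    (by
      rintro U hU
      refine ⟨U, hU, fun g hg => ?_⟩
      rwa [mem_preimage, neg_eq_self])
  have hof : @Continuous X (FreeBoolean e) _ B.topology (of e) := by
    refine (@continuous_iff_continuousAt X (FreeBoolean e) _ B.topology (of e)).2 fun x => ?_
    refine ((B.nhds_hasBasis (of e x)).tendsto_right_iff).2 ?_
    rintro _ ⟨W, hW, rfl⟩
    have hc : Continuous fun y => of e x + of e y := continuous_const.add (continuous_of e)
    have h0 : (fun y => of e x + of e y) ⁻¹' W 0 ∈ 𝓝 x :=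
      hc.continuousAt.preimage_mem_nhds (by rw [add_self]; exact hW 0)
    filter_upwards [h0] with y hy
    -- A generator near `of e x` differs from it by a single pair, placed at index 0, so only `W 0`
    -- restricts y.
    refine ⟨of e x + of e y, ⟨fun i => if i = 0 then of e x + of e y else 0, fun i => ?_, 1, ?_⟩,
      add_add_cancel_self e _ _⟩
    · by_cases hi : i = 0
      · subst hi
        simpa only [if_true] using ⟨hy, x, y, rfl⟩
      · simpa only [hi, if_false] using ⟨hz hW i, e, e, (add_self e _).symm⟩
    · simp
  have hid : @Continuous (FreeBoolean e) (FreeBoolean e) (instTopologicalSpace e) B.topology id :=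
    @continuous_hom X _ e (FreeBoolean e) _ B.topology B.isTopologicalAddGroup
      (AddMonoidHom.id _) hof
  exact (@Continuous.tendsto _ _ _ B.topology _ hid 0)
    (B.mem_nhds_zero ⟨W, hW, rfl⟩)

/-! ### Cauchy filters and reduction to bounded length -/

/-- Cauchy filters of the group uniformity of the free Boolean topological group. -/
structure IsCauchyFilter {X : Type u} [TopologicalSpace X] (e : X) (F : Filter (FreeBoolean e)) :
    Prop where
  neBot : F.NeBot
  exists_add_mem : ∀ U ∈ 𝓝 (0 : FreeBoolean e), ∃ A ∈ F, ∀ a ∈ A, ∀ b ∈ A, a + b ∈ U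

theorem exists_nhds_add {X : Type u} [TopologicalSpace X] (e : X) {U : Set (FreeBoolean e)}
    (hU : U ∈ 𝓝 (0 : FreeBoolean e)) :
    ∃ V ∈ 𝓝 (0 : FreeBoolean e), V ⊆ U ∧ ∀ a ∈ V, ∀ b ∈ V, a + b ∈ U := by
  obtain ⟨V, hV, hVU⟩ := exists_nhds_zero_half hU
  exact ⟨V ∩ U, inter_mem hV hU, inter_subset_right, fun a ha b hb => hVU a ha.1 b hb.1⟩

/-- A Cauchy filter all whose uniform enlargements meet `S` can be replaced by a Cauchy filter
containing `S`. -/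
theorem IsCauchyFilter.exists_mem {X : Type u} [TopologicalSpace X] {e : X}
    {F : Filter (FreeBoolean e)} (hF : IsCauchyFilter e F) (S : Set (FreeBoolean e))
    (hS : ∀ A ∈ F, ∀ U ∈ 𝓝 (0 : FreeBoolean e), ∃ a ∈ A, ∃ u ∈ U, a + u ∈ S) :
    ∃ F', IsCauchyFilter e F' ∧ S ∈ F' ∧ ∀ z, F' ≤ 𝓝 z → F ≤ 𝓝 z := by
  -- The trace on S of the filter generated by the enlargements A + U; the hypothesis says exactly
  -- that it is proper.
  refine ⟨map₂ (· + ·) F (𝓝 0) ⊓ 𝓟 S, ⟨?_, ?_⟩, mem_inf_of_right (mem_principal_self S), ?_⟩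
  · refine inf_principal_neBot_iff.2 ?_
    rintro _ ⟨A, hA, U, hU, h⟩
    obtain ⟨a, ha, u, hu, hs⟩ := hS A hA U hU
    exact ⟨a + u, h (mem_image2_of_mem ha hu), hs⟩
  · intro U hU
    obtain ⟨V, hV, -, hVU⟩ := exists_nhds_add e hU
    obtain ⟨V', hV', -, hVV⟩ := exists_nhds_add e hV
    obtain ⟨A, hA, hAV⟩ := hF.exists_add_mem V hV
    refine ⟨_, mem_inf_of_left (image2_mem_map₂ hA hV'), ?_⟩
    rintro _ ⟨a, ha, x, hx, rfl⟩ _ ⟨b, hb, y, hy, rfl⟩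
    rw [add_add_add_comm]
    exact hVU _ (hAV a ha b hb) _ (hVV x hx y hy)
  · intro z hz W hW
    have hc : Continuous fun g => z + g := by fun_prop
    have h0 : (fun g => z + g) ⁻¹' W ∈ 𝓝 (0 : FreeBoolean e) :=
      hc.continuousAt.preimage_mem_nhds (by rwa [add_zero])
    obtain ⟨V, hV, -, hVU⟩ := exists_nhds_add e h0
    obtain ⟨V', hV', hVV', hVV⟩ := exists_nhds_add e hV
    obtain ⟨A, hA, hAV⟩ := hF.exists_add_mem V' hV'
    have hc' : Continuous fun g => z + g := by fun_prop
    have h1 : (fun g => z + g) ⁻¹' V ∈ 𝓝 z :=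
      hc'.continuousAt.preimage_mem_nhds (by rwa [add_self])
    obtain ⟨_, ⟨A', hA', U', hU', h⟩, T, hT, hAT⟩ := mem_inf_iff_superset.1 (hz h1)
    obtain ⟨a, ha, u, hu, hs⟩ := hS (A ∩ A') (inter_mem hA hA') (V' ∩ U') (inter_mem hV' hU')
    have h2 : z + (a + u) ∈ V :=
      hAT ⟨h (mem_image2_of_mem ha.2 hu.2), mem_principal.1 hT hs⟩
    refine mem_of_superset hA fun b hb => ?_
    -- The element b differs from z by the sum of three small terms: z + (a + u), u and a + b.
    have h3 := hVU _ h2 _ (hVV _ hu.1 _ (hAV a ha.1 b hb))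
    have h4 : z + (z + (a + u) + (u + (a + b))) = b := by
      rw [add_assoc z, add_add_cancel_self, add_assoc, add_add_cancel_self, add_add_cancel_self]
    rw [mem_preimage, h4] at h3
    exact h3

/-- For some `n`, all uniform enlargements of a Cauchy filter meet the set of elements of
length at most `n`. -/
theorem IsCauchyFilter.exists_lengthLE {X : Type u} [TopologicalSpace X] {e : X}
    {F : Filter (FreeBoolean e)} (hF : IsCauchyFilter e F) :
    ∃ n, ∀ A ∈ F, ∀ U ∈ 𝓝 (0 : FreeBoolean e), ∃ a ∈ A, ∃ u ∈ U, a + u ∈ lengthLE e n := by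
  by_contra hcon
  push Not at hcon
  choose A hA U hU hAU using hcon
  have hstep : ∀ (n : ℕ) (W : {W : Set (FreeBoolean e) // W ∈ 𝓝 0}),
      ∃ W' : {W : Set (FreeBoolean e) // W ∈ 𝓝 0}, W'.1 ⊆ U (3 * (n + 1)) ∧
        ∀ a ∈ W'.1, ∀ b ∈ W'.1, a + b ∈ W.1 := by
    rintro n ⟨W, hW⟩
    obtain ⟨V, hV, -, hVW⟩ := exists_nhds_add e hW
    exact ⟨⟨V ∩ U (3 * (n + 1)), inter_mem hV (hU _)⟩, inter_subset_right,
      fun a ha b hb => hVW a ha.1 b hb.1⟩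
  choose c hcU hc using hstep
  -- The index 3n anticipates the end of the proof: a word of length m plus m pairs has length at
  -- most 3m.
  let W : ℕ → {W : Set (FreeBoolean e) // W ∈ 𝓝 0} :=
    fun n => Nat.rec ⟨U 0, hU 0⟩ (fun n W => c n W) n
  have hWU : ∀ n, (W n).1 ⊆ U (3 * n) := by
    rintro (_ | n)
    · exact subset_rfl
    · exact hcU n _
  have hW0 : ∀ n, (0 : FreeBoolean e) ∈ (W n).1 := fun n => mem_of_mem_nhds (W n).2
  have hWadd : ∀ n, ∀ a ∈ (W (n + 1)).1, ∀ b ∈ (W (n + 1)).1, a + b ∈ (W n).1 := fun n => hc n _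
  obtain ⟨A₀, hA₀, hA₀P⟩ := hF.exists_add_mem _
    (pairSums_mem_nhds e (W := fun i => (W (i + 1)).1) fun i => (W (i + 1)).2)
  have := hF.neBot
  obtain ⟨g, hg⟩ := Filter.nonempty_of_mem hA₀
  obtain ⟨s, hs⟩ := exists_finset_sum_eq e g
  set m := s.card
  obtain ⟨h, hh, hhm⟩ := Filter.nonempty_of_mem (inter_mem hA₀ (hA (3 * m)))
  obtain ⟨v, hv, k, hk⟩ := exists_of_mem_pairSums (fun i => hW0 (i + 1)) (hA₀P g hg h hh)
  -- The terms were taken from `W (i + 1)`: the first term and the rest of the tail both lie in `W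
  -- (n + 1)`, so their sum lies in `W n`.
  have htail : ∀ l n, ∑ i ∈ Finset.range l, v (n + i) ∈ (W n).1 := by
    intro l
    induction l with
    | zero => exact hW0
    | succ l ih =>
      intro n
      rw [Finset.sum_range_succ']
      refine hWadd n _ ?_ _ (hv n).1
      have := ih (n + 1)
      simpa only [add_assoc, add_comm 1] using this
  have hsum := hk (m + k) (Nat.le_add_left _ _)
  rw [Finset.sum_range_add] at hsum
  refine hAU (3 * m) h hhm _ (hWU m (htail k m)) ?_
  -- Correcting h by the small tail leaves g plus the first m pairs, a word too short to be allowed.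
  have h1 : h + ∑ i ∈ Finset.range k, v (m + i) = g + ∑ i ∈ Finset.range m, v i := by
    have h2 : h = g + (g + h) := (add_add_cancel_self e g h).symm
    rw [h2, ← hsum, add_assoc, add_assoc, add_self, add_zero]
  rw [h1, show 3 * m = m + 2 * m by ring]
  exact add_mem_lengthLE e ⟨s, le_rfl, hs⟩ (sum_range_mem_lengthLE e (fun i => (hv i).2) m)

/-! ### Seminorms from level sets, and separation of letters -/

/-- If `φ t` are the homomorphisms to the two-element group given by the superlevel sets of `f`,
then `g ↦ measure of {t ∈ [0, 1] | φ t g ≠ 0}` is at most `|f x - f y|` at `of e x + of e y`. -/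
theorem measureReal_superlevel_le {X : Type u} {e : X} {f : X → ℝ} {φ : ℝ → FreeBoolean e →+ ZMod 2}
    (hφ : ∀ t x, φ t (of e x) = (if t < f x then 1 else 0) + (if t < f e then 1 else 0)) (x y : X) :
    (MeasureTheory.volume.restrict (Icc (0 : ℝ) 1)).real {t | φ t (of e x + of e y) ≠ 0} ≤
      |f x - f y| := by
  -- The contributions of e cancel modulo 2, so only levels between the two values of f detect the
  -- pair.
  have hsub : {t | φ t (of e x + of e y) ≠ 0} ⊆ uIcc (f y) (f x) := by
    intro t ht
    rw [mem_ofPred_eq, map_add, hφ, hφ, add_add_add_comm,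
      CharTwo.add_self_eq_zero (if t < f e then (1 : ZMod 2) else 0), add_zero] at ht
    rw [mem_uIcc]
    by_contra hc
    push Not at hc
    apply ht
    by_cases h1 : t < f y <;> by_cases h2 : t < f x
    · simpa [h1, h2] using CharTwo.add_self_eq_zero (1 : ZMod 2)
    · linarith [hc.2 (not_lt.1 h2)]
    · linarith [hc.1 (not_lt.1 h1)]
    · simp [h1, h2]
  calc _ ≤ MeasureTheory.volume.real (uIcc (f y) (f x)) := by
        refine ENNReal.toReal_mono (by simp) ?_
        exact (MeasureTheory.measure_mono hsub).trans
          (MeasureTheory.Measure.restrict_apply_le _ _)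
    _ = |f x - f y| := by simp [MeasureTheory.measureReal_def]

/-- A continuous pseudometric `d` on `X` gives a continuous seminorm on `B(X)` which dominates the
measure seminorms of all functions which are `1`-Lipschitz with respect to `d`. -/
theorem exists_seminorm_of_pseudometric {X : Type u} [TopologicalSpace X] (e : X) {d : X → X → ℝ}
    (hd : IsContinuousPseudometric d) :
    ∃ N : FreeBoolean e → ℝ, Tendsto N (𝓝 0) (𝓝 0) ∧
      ∀ f : X → ℝ, (∀ x y, |f x - f y| ≤ d x y) → ∃ φ : ℝ → FreeBoolean e →+ ZMod 2,
        (∀ t x, φ t (of e x) = (if t < f x then 1 else 0) + (if t < f e then 1 else 0)) ∧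
        ∀ g, (MeasureTheory.volume.restrict (Icc (0 : ℝ) 1)).real {t | φ t g ≠ 0} ≤ N g := by
  let L := {f : X → ℝ // ∀ x y, |f x - f y| ≤ d x y}
  have hL : Nonempty L := ⟨⟨fun _ => 0, fun x y => by simpa using hd.nonneg x y⟩⟩
  choose φ hφ using fun (f : L) (t : ℝ) => exists_hom e CharTwo.add_self_eq_zero
    (fun x => (if t < f.1 x then (1 : ZMod 2) else 0) + (if t < f.1 e then 1 else 0))
    (CharTwo.add_self_eq_zero _)
  let μ : MeasureTheory.Measure ℝ := MeasureTheory.volume.restrict (Icc (0 : ℝ) 1)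
  let n : FreeBoolean e → L → ℝ := fun g f => μ.real {t | φ f t g ≠ 0}
  -- The seminorm will be a supremum over all Lipschitz functions; the finite total mass of [0, 1]
  -- bounds it.
  have hbdd : ∀ g, BddAbove (range (n g)) := by
    intro g
    refine ⟨μ.real univ, ?_⟩
    rintro _ ⟨f, rfl⟩
    exact MeasureTheory.measureReal_mono (subset_univ _)
  let N : AddGroupSeminorm (FreeBoolean e) :=
    { toFun := fun g => ⨆ f, n g f
      map_zero' := by simp [n]
      add_le' := fun a b => by
        refine ciSup_le fun f => le_trans ?_ (add_le_add (le_ciSup (hbdd a) f) (le_ciSup (hbdd b) f))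
        refine (MeasureTheory.measureReal_mono ?_).trans (MeasureTheory.measureReal_union_le _ _)
        intro t ht
        by_contra hc
        simp only [mem_union, mem_ofPred_eq, not_or, not_not] at hc
        exact ht (by rw [map_add, hc.1, hc.2, add_zero])
      neg' := fun a => by simp only [neg_eq_self] }
  let S : SeminormedAddCommGroup (FreeBoolean e) := N.toSeminormedAddCommGroup
  let tS : TopologicalSpace (FreeBoolean e) :=
    S.toPseudoMetricSpace.toUniformSpace.toTopologicalSpace
  have hg : @IsTopologicalAddGroup (FreeBoolean e) tS _ := inferInstance
  have hof : @Continuous X (FreeBoolean e) _ tS (of e) := by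
    rw [continuous_iff_continuousAt]
    intro x
    rw [ContinuousAt, tendsto_iff_norm_sub_tendsto_zero]
    refine squeeze_zero (fun _ => norm_nonneg _) (fun y => ?_) (hd.tendsto x)
    rw [sub_eq_add]
    change (⨆ f, n (of e y + of e x) f) ≤ d x y
    refine ciSup_le fun f => ?_
    refine (measureReal_superlevel_le (hφ f) y x).trans ?_
    rw [hd.comm x y]
    exact f.2 y x
  have hn : @Continuous (FreeBoolean e) ℝ tS _ N := continuous_norm
  have hid : @Continuous (FreeBoolean e) (FreeBoolean e) (instTopologicalSpace e) tS id :=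
    @continuous_hom X _ e (FreeBoolean e) _ tS hg (AddMonoidHom.id _) hof
  have hc : @Continuous (FreeBoolean e) ℝ (instTopologicalSpace e) _ N :=
    @Continuous.comp _ _ _ (instTopologicalSpace e) tS _ _ _ hn hid
  have h0 := @Continuous.tendsto' _ _ (instTopologicalSpace e) _ _ hc 0 0 (map_zero N)
  refine ⟨N, h0, fun f hf => ⟨φ ⟨f, hf⟩, hφ ⟨f, hf⟩, fun g => ?_⟩⟩
  exact le_ciSup (hbdd g) ⟨f, hf⟩

/-- Close elements of `B(X)` have close letters. -/
theorem exists_nhds_close {X : Type u} [TopologicalSpace X] (e : X) {d : X → X → ℝ}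
    (hd : IsContinuousPseudometric d) {r : ℝ} (hr : 0 < r) (hr1 : r ≤ 1) :
    ∃ U ∈ 𝓝 (0 : FreeBoolean e), ∀ s t : Finset X, ∑ x ∈ s, of e x + ∑ x ∈ t, of e x ∈ U →
      ∀ x ∈ s, (∀ y ∈ s, y ≠ x → r ≤ d x y) → r ≤ d x e → ∃ y ∈ t, d x y < r := by
  obtain ⟨N, hN, hNf⟩ := exists_seminorm_of_pseudometric e hd
  refine ⟨N ⁻¹' Iio r, hN (Iio_mem_nhds hr), fun s t hst x hx hxs hxe => ?_⟩
  by_contra hcon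
  push Not at hcon
  -- This test function is positive only within distance r of x. At every level in [0, r) it sees
  -- exactly the letter x of s and, if the claim fails, no letter of t, so the seminorm is at least
  -- r.
  obtain ⟨φ, hφ, hle⟩ := hNf (fun y => r - d x y) fun y z => by
    rw [abs_le]
    constructor
    · linarith [hd.triangle x z y, hd.comm y z]
    · linarith [hd.triangle x y z]
  have key : Ico 0 r ⊆ {τ | φ τ (∑ x ∈ s, of e x + ∑ x ∈ t, of e x) ≠ 0} := by
    intro τ hτ
    have hφ' : ∀ y, r ≤ d x y → φ τ (of e y) = 0 := fun y hy => by
      rw [hφ, if_neg (by linarith [hτ.1]), if_neg (by linarith [hτ.1]), add_zero]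
    have hs : φ τ (∑ x ∈ s, of e x) = 1 := by
      rw [map_sum, Finset.sum_eq_single_of_mem x hx fun y hy hyx => hφ' y (hxs y hy hyx), hφ,
        if_pos (by rw [hd.self]; linarith [hτ.2]), if_neg (by linarith [hτ.1]), add_zero]
    have ht : φ τ (∑ x ∈ t, of e x) = 0 := by
      rw [map_sum]
      exact Finset.sum_eq_zero fun y hy => hφ' y (hcon y hy)
    rw [mem_ofPred_eq, map_add, hs, ht, add_zero]
    exact one_ne_zero
  have h1 := MeasureTheory.measureReal_mono (μ := MeasureTheory.volume.restrict (Icc (0 : ℝ) 1)) key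
  have h2 : (MeasureTheory.volume.restrict (Icc (0 : ℝ) 1)).real (Ico (0 : ℝ) r) = r := by
    rw [MeasureTheory.measureReal_restrict_apply measurableSet_Ico,
      inter_eq_left.2 (Ico_subset_Icc_self.trans (Icc_subset_Icc_right hr1))]
    simp [hr.le]
  rw [h2] at h1
  exact absurd hst (not_lt.2 (h1.trans (hle _)))

/-- A neighbourhood `U` of zero gives a continuous pseudometric on `X` which separates the letters of
every word of length `n + 1` whose translates by `U` avoid the words of length at most `n`. -/
theorem exists_separating_pseudometric {X : Type u} [TopologicalSpace X] (e : X)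
    {U : Set (FreeBoolean e)} (hU : U ∈ 𝓝 (0 : FreeBoolean e)) (n : ℕ) :
    ∃ d : X → X → ℝ, IsContinuousPseudometric d ∧ ∀ s : Finset X, s.card ≤ n + 1 →
      (∀ u ∈ U, ∑ x ∈ s, of e x + u ∉ lengthLE e n) →
      ∀ x ∈ s, (∀ y ∈ s, y ≠ x → 1 ≤ d x y) ∧ 1 ≤ d x e := by
  classical
  let u₀ : UniformSpace (FreeBoolean e) := IsTopologicalAddGroup.leftUniformSpace _
  have hV : {p : FreeBoolean e × FreeBoolean e | p.1 + p.2 ∈ U} ∈ uniformity (FreeBoolean e) := by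
    refine ⟨U, hU, fun p hp => ?_⟩
    rwa [mem_preimage, neg_eq_self] at hp
  obtain ⟨d, hd, hdV⟩ := exists_isContinuousPseudometric hV
  have hd' := hd.comp (continuous_of e)
  -- Adding a letter of a word deletes it. If two letters, or a letter and e, were at distance below
  -- 1, an element of U would delete them and leave length at most n.
  have herase : ∀ s : Finset X, ∀ x ∈ s, ∑ y ∈ s, of e y + of e x = ∑ y ∈ s.erase x, of e y := by
    intro s x hx
    rw [← Finset.add_sum_erase s _ hx, add_comm, add_add_cancel_self]
  refine ⟨_, hd', fun s hs hsU x hx => ⟨fun y hy hyx => ?_, ?_⟩⟩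
  · by_contra! h
    refine hsU _ (hdV _ _ h) ⟨(s.erase x).erase y, ?_, ?_⟩
    · refine (Finset.card_le_card (Finset.erase_subset _ _)).trans ?_
      rw [Finset.card_erase_of_mem hx]
      omega
    · rw [← add_assoc, herase s x hx, herase _ y (Finset.mem_erase.2 ⟨hyx, hy⟩)]
  · by_contra! h
    refine hsU _ (hdV _ _ h) ⟨s.erase x, ?_, ?_⟩
    · rw [Finset.card_erase_of_mem hx]
      omega
    · simp only [of_base, add_zero, herase s x hx]

/-! ### Convergence of Cauchy filters of bounded length -/

/-- If the topology of `X` is induced by a complete uniformity, then every Cauchy filter on `B(X)`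
which consists of elements of bounded length converges. -/
theorem IsCauchyFilter.exists_le_nhds_of_lengthLE {X : Type u} [UniformSpace X] [CompleteSpace X]
    {e : X} (n : ℕ) : ∀ {F : Filter (FreeBoolean e)}, IsCauchyFilter e F → lengthLE e n ∈ F →
      ∃ z, F ≤ 𝓝 z := by
  classical
  induction n with
  | zero =>
    intro F hF hn
    refine ⟨0, le_trans (le_pure_iff.2 (mem_of_superset hn ?_)) (pure_le_nhds _)⟩
    rintro _ ⟨s, hs, rfl⟩
    rw [Finset.card_eq_zero.1 (Nat.le_zero.1 hs)]
    exact Finset.sum_empty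
  | succ n ih =>
    intro F hF hn
    by_cases hS : ∀ A ∈ F, ∀ U ∈ 𝓝 (0 : FreeBoolean e), ∃ a ∈ A, ∃ u ∈ U, a + u ∈ lengthLE e n
    · obtain ⟨F', hF', hn', hFF'⟩ := hF.exists_mem _ hS
      obtain ⟨z, hz⟩ := ih hF' hn'
      exact ⟨z, hFF' z hz⟩
    push Not at hS
    obtain ⟨A, hA, U, hU, hAU⟩ := hS
    obtain ⟨d, hd, hdU⟩ := exists_separating_pseudometric e hU n
    have hword : ∀ g, ∃ s : Finset X, g ∈ A ∩ lengthLE e (n + 1) → s.card = n + 1 ∧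
        ∑ x ∈ s, of e x = g ∧ ∀ x ∈ s, (∀ y ∈ s, y ≠ x → 1 ≤ d x y) ∧ 1 ≤ d x e := by
      intro g
      by_cases hg : g ∈ A ∩ lengthLE e (n + 1)
      · obtain ⟨hgA, s, hs, rfl⟩ := hg
        refine ⟨s, fun _ => ⟨le_antisymm hs ?_, rfl, hdU s hs (hAU _ hgA)⟩⟩
        by_contra h
        refine hAU _ hgA 0 (mem_of_mem_nhds hU) ?_
        rw [add_zero]
        exact ⟨s, by omega, rfl⟩
      · exact ⟨∅, fun h => absurd h hg⟩
    choose s hs using hword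
    -- Enlarging d keeps the letters separated, so closeness of letters is available for every
    -- continuous pseudometric above d.
    have hclose : ∀ {d' : X → X → ℝ}, IsContinuousPseudometric d' → (∀ x y, d x y ≤ d' x y) →
        ∀ {r : ℝ}, 0 < r → r ≤ 1 → ∃ A' ∈ F, A' ⊆ A ∩ lengthLE e (n + 1) ∧
          ∀ g ∈ A', ∀ h ∈ A', ∀ x ∈ s g, ∃ y ∈ s h, d' x y < r := by
      intro d' hd' hdd' r hr hr1
      obtain ⟨U', hU', hUs⟩ := exists_nhds_close e hd' hr hr1
      obtain ⟨A', hA', hAU'⟩ := hF.exists_add_mem U' hU'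
      refine ⟨A' ∩ (A ∩ lengthLE e (n + 1)), inter_mem hA' (inter_mem hA hn), inter_subset_right,
        fun g hg h hh x hx => ?_⟩
      obtain ⟨-, hsg, hsep⟩ := hs g hg.2
      obtain ⟨-, hsh, -⟩ := hs h hh.2
      refine hUs (s g) (s h) (by rw [hsg, hsh]; exact hAU' g hg.1 h hh.1) x hx
        (fun y hy hyx => hr1.trans (((hsep x hx).1 y hy hyx).trans (hdd' x y)))
        (hr1.trans ((hsep x hx).2.trans (hdd' x e)))
    -- With 1/3, a chain of three such steps stays below the separation 1; this identifies letters
    -- below.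
    obtain ⟨A₀, hA₀, hA₀A, hA₀s⟩ := hclose hd (fun _ _ => le_rfl) (r := 1 / 3) (by norm_num)
      (by norm_num)
    have := hF.neBot
    obtain ⟨g₀, hg₀⟩ := Filter.nonempty_of_mem hA₀
    have hletter : ∀ x g, ∃ y, x ∈ s g₀ → g ∈ A₀ → y ∈ s g ∧ d x y < 1 / 3 := by
      intro x g
      by_cases hx : x ∈ s g₀ ∧ g ∈ A₀
      · obtain ⟨y, hy⟩ := hA₀s g₀ hg₀ g hx.2 x hx.1
        exact ⟨y, fun _ _ => hy⟩
      · exact ⟨e, fun h h' => absurd ⟨h, h'⟩ hx⟩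
    choose c hc using hletter
    -- By separation, distinct letters of `s g₀` have distinct companions in `s g`; both words have
    -- n + 1 letters, so all of `s g` is reached.
    have hsum : ∀ g ∈ A₀, ∑ x ∈ s g₀, of e (c x g) = g := by
      intro g hg
      have hinj : Set.InjOn (fun x => c x g) (s g₀ : Set X) := by
        intro x hx y hy hxy
        by_contra hne
        have h1 := ((hs g₀ (hA₀A hg₀)).2.2 x hx).1 y hy (Ne.symm hne)
        have h2 := (hc x g hx hg).2
        have h3 := (hc y g hy hg).2
        rw [← show c x g = c y g from hxy, hd.comm] at h3
        linarith [hd.triangle x (c x g) y]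
      have himg : (s g₀).image (fun x => c x g) = s g := by
        refine Finset.eq_of_subset_of_card_le
          (Finset.image_subset_iff.2 fun x hx => (hc x g hx hg).1) ?_
        rw [Finset.card_image_of_injOn hinj, (hs g₀ (hA₀A hg₀)).1, (hs g (hA₀A hg)).1]
      rw [← Finset.sum_image (f := of e) hinj, himg, (hs g (hA₀A hg)).2.1]
    have hlim : ∀ x, ∃ z, x ∈ s g₀ → Tendsto (c x) F (𝓝 z) := by
      intro x
      by_cases hx : x ∈ s g₀
      swap
      · exact ⟨e, fun h => absurd h hx⟩
      have hcauchy : Cauchy (map (c x) F) := by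
        refine ⟨inferInstance, fun V hV => ?_⟩
        obtain ⟨d₁, hd₁, hdV⟩ := exists_isContinuousPseudometric hV
        -- In the sum of pseudometrics, `d` forces the letter of h close to `c x g` to be `c x h`,
        -- and `d₁` then gives the required entourage.
        obtain ⟨A', hA', -, hAs⟩ := hclose (hd.add hd₁)
          (fun y z => le_add_of_nonneg_right (hd₁.nonneg y z)) (r := 1 / 3) (by norm_num)
          (by norm_num)
        refine mem_of_superset (prod_mem_prod (image_mem_map (inter_mem hA' hA₀))
          (image_mem_map (inter_mem hA' hA₀))) ?_
        rintro ⟨_, _⟩ ⟨⟨g, hg, rfl⟩, h, hh, rfl⟩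
        have h1 := hc x g hx hg.2
        have h2 := hc x h hx hh.2
        obtain ⟨y, hy, hgy⟩ := hAs g hg.1 h hh.1 _ h1.1
        have hyc : y = c x h := by
          by_contra hne
          have h3 := ((hs h (hA₀A hh.2)).2.2 _ h2.1).1 y hy hne
          have h4 := hd.triangle (c x h) x y
          have h5 := hd.triangle x (c x g) y
          rw [hd.comm (c x h) x] at h4
          linarith [hd₁.nonneg (c x g) y, h1.2, h2.2]
        rw [hyc] at hgy
        exact hdV _ _ (by linarith [hd.nonneg (c x g) (c x h)])
      obtain ⟨z, hz⟩ := CompleteSpace.complete hcauchy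
      exact ⟨z, fun _ => hz⟩
    choose z hz using hlim
    refine ⟨∑ x ∈ s g₀, of e (z x), ?_⟩
    have h1 : Tendsto (fun g => ∑ x ∈ s g₀, of e (c x g)) F (𝓝 (∑ x ∈ s g₀, of e (z x))) :=
      tendsto_finsetSum _ fun x hx => ((continuous_of e).tendsto (z x)).comp (hz x hx)
    have h2 : (fun g => ∑ x ∈ s g₀, of e (c x g)) =ᶠ[F] id := by
      filter_upwards [hA₀] with g hg
      exact hsum g hg
    exact h1.congr' h2

theorem weilComplete_of_dieudonneComplete {X : Type u} [TopologicalSpace X] (e : X)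
    (h : DieudonneComplete X) : WeilComplete (FreeBoolean e) := by
  obtain ⟨U, rfl, hU⟩ := h
  refine @CompleteSpace.mk _ (IsTopologicalAddGroup.leftUniformSpace _) fun {F} hF => ?_
  have hF' : IsCauchyFilter e F := by
    refine ⟨hF.1, fun V hV => ?_⟩
    have h1 : {p : FreeBoolean e × FreeBoolean e | p.1 + p.2 ∈ V} ∈ F ×ˢ F := by
      refine hF.2 ⟨V, hV, fun p hp => ?_⟩
      rwa [mem_preimage, neg_eq_self] at hp
    obtain ⟨A, hA, hAV⟩ := mem_prod_same_iff.1 h1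
    exact ⟨A, hA, fun a ha b hb => hAV (mk_mem_prod ha hb)⟩
  obtain ⟨n, hn⟩ := hF'.exists_lengthLE
  obtain ⟨G, hG, hnG, hFG⟩ := hF'.exists_mem _ hn
  obtain ⟨z, hz⟩ := hG.exists_le_nhds_of_lengthLE n hnG
  exact ⟨z, hFG z hz⟩

/-! ### Closedness of X in B(X) and the converse -/

/-- For a Tychonoff space `X` the image of `X` in `B(X)` is closed. -/
theorem isClosed_range_of {X : Type u} [TopologicalSpace X] [T35Space X] (e : X) :
    IsClosed (range (of e)) := by
  classical
  rw [← isOpen_compl_iff, isOpen_iff_mem_nhds]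
  intro g hg
  obtain ⟨s, hsg⟩ := exists_finset_sum_eq e g
  -- Dropping e does not change the sum. Since g is not a generator, at least two letters a and b
  -- remain.
  obtain ⟨s, hsg, hes⟩ : ∃ s : Finset X, ∑ x ∈ s, of e x = g ∧ e ∉ s :=
    ⟨s.erase e, by rw [Finset.sum_erase s (of_base e), hsg], Finset.notMem_erase e s⟩
  have hcard : 1 < s.card := by
    by_contra! h
    have : Nonempty X := ⟨e⟩
    obtain ⟨x, hx⟩ := Finset.card_le_one_iff_subset_singleton.1 h
    rcases Finset.subset_singleton_iff.1 hx with rfl | rfl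
    · exact hg ⟨e, by rw [of_base, ← hsg, Finset.sum_empty]⟩
    · exact hg ⟨x, by rw [← hsg, Finset.sum_singleton]⟩
  obtain ⟨a, ha, b, hb, hab⟩ := Finset.one_lt_card.1 hcard
  have hbump : ∀ x ∈ s, ∃ f : X → ℝ, Continuous f ∧ f x = 1 ∧ (∀ y, 0 ≤ f y) ∧
      ∀ y ∈ insert e (s.erase x), f y = 0 := by
    intro x hx
    have hxK : x ∉ (insert e (s.erase x) : Finset X) := by
      simp only [Finset.mem_insert, Finset.mem_erase, ne_eq, not_true, false_and, or_false]
      rintro rfl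
      exact hes hx
    obtain ⟨f, hf, hfx, hfK⟩ := CompletelyRegularSpace.completely_regular x
      ((insert e (s.erase x) : Finset X) : Set X) (Finset.finite_toSet _).isClosed hxK
    refine ⟨fun y => 1 - (f y : ℝ), by fun_prop, by simp [hfx], fun y => ?_, fun y hy => ?_⟩
    · linarith [(f y).2.2]
    · have : f y = 1 := hfK hy
      simp [this]
  obtain ⟨p, hp, hpa, hp0, hpK⟩ := hbump a ha
  obtain ⟨q, hq, hqb, hq0, hqK⟩ := hbump b hb
  -- At each level in [0, 1) the word g shows only its letter x, while generators at points with f ≤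
  -- 0 show nothing.
  have hmeas : ∀ f : X → ℝ, Continuous f → f e ≤ 0 → ∀ x ∈ s, f x = 1 →
      (∀ y ∈ s, y ≠ x → f y ≤ 0) → ∃ N : FreeBoolean e → ℝ, Continuous N ∧ 1 ≤ N g ∧
        ∀ y, f y ≤ 0 → N (of e y) ≤ 0 := by
    intro f hf hfe x hx hfx hfs
    obtain ⟨φ, hφ, hN⟩ := exists_seminorm e f hf
    have hφ0 : ∀ t ∈ Ico (0 : ℝ) 1, ∀ y, f y ≤ 0 → φ t (of e y) = 0 := fun t ht y hy => by
      rw [hφ, if_neg (by linarith [ht.1]), if_neg (by linarith [ht.1]), add_zero]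
    refine ⟨_, hN, ?_, fun y hy => ?_⟩
    · have key : Ico (0 : ℝ) 1 ⊆ {t | φ t g ≠ 0} := by
        intro t ht
        rw [mem_ofPred_eq, ← hsg, map_sum,
          Finset.sum_eq_single_of_mem x hx fun y hy hyx => hφ0 t ht y (hfs y hy hyx), hφ,
          if_pos (by rw [hfx]; exact ht.2), if_neg (by linarith [ht.1]), add_zero]
        exact one_ne_zero
      have h1 := MeasureTheory.measureReal_mono
        (μ := MeasureTheory.volume.restrict (Icc (0 : ℝ) 1)) key
      rwa [MeasureTheory.measureReal_restrict_apply measurableSet_Ico,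
        inter_eq_left.2 Ico_subset_Icc_self, Real.volume_real_Ico_of_le zero_le_one, sub_zero] at h1
    · have key : {t | φ t (of e y) ≠ 0} ∩ Icc 0 1 ⊆ {1} := by
        rintro t ⟨ht, ht'⟩
        by_contra hne
        exact ht (hφ0 t ⟨ht'.1, lt_of_le_of_ne ht'.2 hne⟩ y hy)
      have h0 : (MeasureTheory.volume.restrict (Icc (0 : ℝ) 1)) {t | φ t (of e y) ≠ 0} = 0 := by
        rw [MeasureTheory.Measure.restrict_apply' measurableSet_Icc]
        exact MeasureTheory.measure_mono_null key Real.volume_singleton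
      rw [MeasureTheory.measureReal_def, h0, ENNReal.toReal_zero]
  have he : ∀ {x}, e ∈ insert e (s.erase x) := Finset.mem_insert_self _ _
  have hmem : ∀ {x y}, y ∈ s → y ≠ x → y ∈ insert e (s.erase x) := fun hy hyx =>
    Finset.mem_insert_of_mem (Finset.mem_erase.2 ⟨hyx, hy⟩)
  -- At every point p - q or q - p is nonpositive, so no generator makes both seminorms positive,
  -- whereas both are at least 1 at g.
  obtain ⟨N, hN, hNg, hN0⟩ := hmeas (fun y => p y - q y) (hp.sub hq)
    (by rw [hpK e he]; linarith [hq0 e]) a ha (by rw [hpa, hqK a (hmem ha hab), sub_zero])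
    (fun y hy hya => by rw [hpK y (hmem hy hya)]; linarith [hq0 y])
  obtain ⟨M, hM, hMg, hM0⟩ := hmeas (fun y => q y - p y) (hq.sub hp)
    (by rw [hqK e he]; linarith [hp0 e]) b hb (by rw [hqb, hpK b (hmem hb hab.symm), sub_zero])
    (fun y hy hyb => by rw [hqK y (hmem hy hyb)]; linarith [hp0 y])
  filter_upwards [hN.continuousAt.preimage_mem_nhds (Ioi_mem_nhds (zero_lt_one.trans_le hNg)),
    hM.continuousAt.preimage_mem_nhds (Ioi_mem_nhds (zero_lt_one.trans_le hMg))] with h h1 h2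
  rintro ⟨y, rfl⟩
  rcases le_total (p y) (q y) with h3 | h3
  · exact absurd (hN0 y (sub_nonpos.2 h3)) (not_le.2 h1)
  · exact absurd (hM0 y (sub_nonpos.2 h3)) (not_le.2 h2)

theorem dieudonneComplete_of_weilComplete {X : Type u} [TopologicalSpace X] [T35Space X] (e : X)
    (h : WeilComplete (FreeBoolean e)) : DieudonneComplete X := by
  let u₀ : UniformSpace (FreeBoolean e) := IsTopologicalAddGroup.leftUniformSpace _
  have : CompleteSpace (FreeBoolean e) := h
  refine ⟨u₀.comap (of e), (isEmbedding_of e).eq_induced.symm, ?_⟩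
  let _ : UniformSpace X := u₀.comap (of e)
  have hi : IsUniformInducing (of e) := ⟨rfl⟩
  exact (completeSpace_iff_isComplete_range hi).2 (isClosed_range_of e).isComplete

end FreeBoolean

/-! ### Comparison of the completeness notions -/

/-- By commutativity the left and right uniformities coincide. -/
theorem weilComplete_iff_raikovComplete (G : Type u) [AddCommGroup G] [TopologicalSpace G]
    [IsTopologicalAddGroup G] : WeilComplete G ↔ RaikovComplete G := by
  have h : IsTopologicalAddGroup.leftUniformSpace G = IsTopologicalAddGroup.rightUniformSpace G := by
    refine UniformSpace.ext ?_
    change comap (fun p : G × G => -p.1 + p.2) (𝓝 0) = comap (fun p : G × G => p.2 + -p.1) (𝓝 0)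
    simp only [add_comm]
  rw [WeilComplete, RaikovComplete, ← h, inf_idem]

/-- A Cauchy filter of the finest uniformity is Cauchy for every compatible one, and its limit
depends only on the common topology. -/
theorem dieudonneComplete_iff_universalUniformity (X : Type u) [t : TopologicalSpace X]
    [CompletelyRegularSpace X] :
    DieudonneComplete X ↔ @CompleteSpace X (universalUniformity X) := by
  refine ⟨?_, fun h => ⟨_, universalUniformity_toTopologicalSpace X, h⟩⟩
  rintro ⟨U, hU, hc⟩
  refine @CompleteSpace.mk X (universalUniformity X) fun {F} hF => ?_
  have hle : universalUniformity X ≤ U := sInf_le hU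
  obtain ⟨x, hx⟩ := hc.complete (hF.mono_uniformSpace hle)
  refine ⟨x, ?_⟩
  rwa [universalUniformity_toTopologicalSpace X, ← hU]

/-- The free Boolean topological group on a Tychonoff space `X` (with any distinguished point `e`)
is Weil complete, equivalently Raikov complete, if and only if `X` is Dieudonné complete,
equivalently, the universal uniformity of `X` is complete. -/
theorem theorem1 {X : Type u} [TopologicalSpace X] [T35Space X] (e : X) :
    (WeilComplete (FreeBoolean e) ↔ DieudonneComplete X) ∧
    (WeilComplete (FreeBoolean e) ↔ RaikovComplete (FreeBoolean e)) ∧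
    (DieudonneComplete X ↔ @CompleteSpace X (universalUniformity X)) :=
  ⟨⟨FreeBoolean.dieudonneComplete_of_weilComplete e,
      FreeBoolean.weilComplete_of_dieudonneComplete e⟩,
    weilComplete_iff_raikovComplete _, dieudonneComplete_iff_universalUniformity X⟩
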